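/- Let $S=[\underline s,\overline s]\subset\mathbb R$ with $\underline s<\overline s$. The state $s\in S$ is distributed according to a probability distribution $F$ with support $S$ and a density $f$ that is differentiable on $S$. From action $a\in\mathbb R$ in state $s$ the agent gets $u_A(a,s)=as+b(a)$ and the principal gets $u_P(a,s)=a(s+\beta)+b(a)$, where $\beta\in\mathbb R$ and $b:\mathbb R\to\mathbb R$ is strictly concave and differentiable with Lipschitz-continuous derivative, and $b(a)/|a|\to-\infty$ as $|a|\to\infty$. (This is the one-dimensional model with $\kappa=1$ and constant bias $g(s)=s+\beta$.) A mechanism $m$ assigns to each $s\in S$ a Borel probability measure $m(s)$ on the set $\mathbb R$ of actions such that expected payoffs are integrable; $u_A(m(s'),s)$ and $u_P(m(s'),s)$ denote expected payoffs under $m(s')$. It is incentive compatible if $u_A(m(s),s)\ge u_A(m(s'),s)$ for all $s,s'\in S$, and optimal if it maximizes $\int_S u_P(m(s),s)\,dF(s)$ over all incentive-compatible mechanisms. For $s\in\mathbb R$, the first-best action of $s$ is the maximizer of $a\mapsto as+b(a)$. For an interval $[s_1,s_2]\subset\mathbb R$ with $s_1\le s_2$, delegating to $[s_1,s_2]$ is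 optimal if there is an optimal mechanism that gives every type $s\in S$, with certainty, the action that $s$ prefers most among the first-best actions of the points of $[s_1,s_2]$; so $s\in S\cap[s_1,s_2]$ gets its first-best action, and types below $s_1$ (above $s_2$) get the first-best action of $s_1$ (of $s_2$). Suppose that $f$ is log-concave. Then delegating to an interval is optimal: there are real numbers $s_1\le s_2$ such that delegating to $[s_1,s_2]$ is optimal. Moreover, if $\mathbb E_F[s]+\beta\in S$, such $s_1,s_2$ can be chosen in $S$. -/

import Mathlib

open MeasureTheory Set Filter Topology

noncomputable section

namespace Delegation

/-- The agent's payoff `u_A(a, s) = a s + b(a)` from action `a` in state `s`. -/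
def uA (b : ℝ → ℝ) (a s : ℝ) : ℝ := a * s + b a

/-- The principal's payoff `u_P(a, s) = a g(s) + κ b(a)` from action `a` in state `s`. -/
def uP (b g : ℝ → ℝ) (κ : ℝ) (a s : ℝ) : ℝ := a * g s + κ * b a

/-- The agent's expected payoff from the lottery `p` over actions in state `s`. -/
def expUA (b : ℝ → ℝ) (p : ProbabilityMeasure ℝ) (s : ℝ) : ℝ :=
  ∫ a, uA b a s ∂(p : Measure ℝ)

/-- The principal's expected payoff from the lottery `p` over actions in state `s`. -/
def expUP (b g : ℝ → ℝ) (κ : ℝ) (p : ProbabilityMeasure ℝ) (s : ℝ) : ℝ :=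
  ∫ a, uP b g κ a s ∂(p : Measure ℝ)

/-- The standing assumptions on `b`: it is strictly concave, differentiable with a Lipschitz
continuous derivative, and `b(a) / |a| → -∞` as `|a| → ∞`. -/
structure AdmissibleUtility (b : ℝ → ℝ) : Prop where
  strictConcave : StrictConcaveOn ℝ univ b
  differentiable : Differentiable ℝ b
  lipschitz_deriv : ∃ K : NNReal, LipschitzWith K (deriv b)
  superlinear : Tendsto (fun a => b a / |a|) (cocompact ℝ) atBot

/-- The distribution of the state on the type space `S` with Lebesgue density `f`. -/
def stateDist (S : Set ℝ) (f : ℝ → ℝ) : Measure ℝ :=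
  (volume.restrict S).withDensity (fun s => ENNReal.ofReal (f s))

/-- `f` is a differentiable probability density on `S` whose distribution has support `S`. -/
structure IsTypeDensity (S : Set ℝ) (f : ℝ → ℝ) : Prop where
  nonneg : ∀ s ∈ S, 0 ≤ f s
  differentiable : DifferentiableOn ℝ f S
  isProbability : IsProbabilityMeasure (stateDist S f)
  support_eq : (stateDist S f).support = S

/-- A nonnegative function `f` is log-concave on the interval `S`. -/
def LogConcaveOn (S : Set ℝ) (f : ℝ → ℝ) : Prop :=
  ∀ x ∈ S, ∀ y ∈ S, ∀ t ∈ Icc (0 : ℝ) 1, f x ^ t * f y ^ (1 - t) ≤ f (t * x + (1 - t) * y)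

/-- A (direct, stochastic) mechanism on the type space `S` assigns to every type in `S` a lottery
over actions such that expected payoffs are integrable. Values off `S` are irrelevant. -/
structure IsMechanism (S : Set ℝ) (f b g : ℝ → ℝ) (κ : ℝ) (m : ℝ → ProbabilityMeasure ℝ) :
    Prop where
  integrable_action : ∀ s ∈ S, Integrable (fun a : ℝ => a) (m s : Measure ℝ)
  integrable_utility : ∀ s ∈ S, Integrable b (m s : Measure ℝ)
  integrable_agent : Integrable (fun s => expUA b (m s) s) (stateDist S f)
  integrable_principal : Integrable (fun s => expUP b g κ (m s) s) (stateDist S f)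

/-- Incentive compatibility: truthful reporting is optimal for every type in `S`. -/
def IncentiveCompatible (S : Set ℝ) (b : ℝ → ℝ) (m : ℝ → ProbabilityMeasure ℝ) : Prop :=
  ∀ s ∈ S, ∀ s' ∈ S, expUA b (m s') s ≤ expUA b (m s) s

/-- The principal's ex-ante expected payoff from the mechanism `m`. -/
def principalValue (S : Set ℝ) (f b g : ℝ → ℝ) (κ : ℝ) (m : ℝ → ProbabilityMeasure ℝ) : ℝ :=
  ∫ s, expUP b g κ (m s) s ∂(stateDist S f)

/-- `m` maximizes the principal's expected payoff among all incentive-compatible mechanisms. -/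
structure IsOptimal (S : Set ℝ) (f b g : ℝ → ℝ) (κ : ℝ) (m : ℝ → ProbabilityMeasure ℝ) :
    Prop where
  isMechanism : IsMechanism S f b g κ m
  incentiveCompatible : IncentiveCompatible S b m
  maximal : ∀ m', IsMechanism S f b g κ m' → IncentiveCompatible S b m' →
    principalValue S f b g κ m' ≤ principalValue S f b g κ m

/-- `a` is a first-best action of type `s`. -/
def IsFirstBest (b : ℝ → ℝ) (a s : ℝ) : Prop := ∀ a', uA b a' s ≤ uA b a s

/-- The first-best actions of the types in `A`. -/
def firstBestActions (b : ℝ → ℝ) (A : Set ℝ) : Set ℝ := {a | ∃ s ∈ A, IsFirstBest b a s}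

/-- `m` is delegation to `A`: every type in `S` gets, deterministically, its most preferred action
among the first-best actions of types in `A`. (A type in `A` thus gets its first-best action.) -/
def IsDelegationTo (S : Set ℝ) (b : ℝ → ℝ) (A : Set ℝ) (m : ℝ → ProbabilityMeasure ℝ) : Prop :=
  ∀ s ∈ S, ∃ a ∈ firstBestActions b A,
    (∀ a' ∈ firstBestActions b A, uA b a' s ≤ uA b a s) ∧ (m s : Measure ℝ) = Measure.dirac a

/-- Delegating to `A` is optimal: some optimal mechanism is delegation to `A`. -/
def DelegationOptimal (S : Set ℝ) (f b g : ℝ → ℝ) (κ : ℝ) (A : Set ℝ) : Prop :=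
  ∃ m, IsOptimal S f b g κ m ∧ IsDelegationTo S b A m

end Delegation

end

/-! Incentive compatibility makes the agent's indirect utility `U` convex with the mean action `a`
as subgradient, and the principal gets `U + β a`. Every tangent of `U` is the payoff from some
lottery, so it lies below the first-best value `V` on all of `ℝ`. It suffices to maximize over such
`U` (`DelegationBound`) and to check that delegation attains the maximum. Take `β > 0`. Integration
by parts puts the weight `f - β f'` on `U`, plus boundary terms. By log-concavity `exp (-s/β) f s`
is quasi-concave, so the weight changes sign once, at a maximizer `c`, from nonpositive to
nonnegative (`exists_singleCrossing`). For `x ≥ c`, the chord of `U` through `c` and `x` lies below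
`U` left of `c` and above it on `[c, x]`, so substituting it on `[lo, x]` does not hurt
(`exists_affine_ge`). The slope of the chord enters the objective only through `cumMoment` at `x`.
If `cumMoment` has a root `x` in `[c, hi]`, the slope drops out, and raising `U` to `V` on `[x, hi]`
gives delegation to `[x, hi]` (`delegationBound_of_root`). Otherwise the mean state plus `β` is at
least `hi`, and the first-best action of that point is optimal for all types
(`delegationBound_of_neg`). For `β = 0` full delegation is optimal; `β < 0` follows by reflecting
the state. -/

namespace Delegation

/-! ### Convex functions through their subgradients -/

/-- `a s` is a subgradient of `U` at every `s ∈ S`, relative to `S`. -/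
def IsSubgradientOn (S : Set ℝ) (U a : ℝ → ℝ) : Prop :=
  ∀ s ∈ S, ∀ s' ∈ S, U s' + a s' * (s - s') ≤ U s

namespace IsSubgradientOn

variable {S T : Set ℝ} {U a : ℝ → ℝ} {p q : ℝ}

theorem mono (h : IsSubgradientOn S U a) (hT : T ⊆ S) : IsSubgradientOn T U a :=
  fun s hs s' hs' => h s (hT hs) s' (hT hs')

theorem affine (S : Set ℝ) (u k x : ℝ) :
    IsSubgradientOn S (fun s => u + k * (s - x)) (fun _ => k) := by
  intro s _ s' _
  apply le_of_eq
  ring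

theorem monotoneOn (h : IsSubgradientOn S U a) : MonotoneOn a S := by
  intro s hs s' hs' hss
  rcases hss.eq_or_lt with rfl | hlt
  · exact le_rfl
  · have h1 := h s hs s' hs'
    have h2 := h s' hs' s hs
    by_contra! hc
    nlinarith [mul_pos (sub_pos.2 hc) (sub_pos.2 hlt)]

/-- Monotonicity bounds `a` by its values at the endpoints, so `U` is Lipschitz up to and including
them. -/
theorem continuousOn (h : IsSubgradientOn (Icc p q) U a) : ContinuousOn U (Icc p q) := by
  rcases lt_or_ge q p with hpq | hpq
  · simp [Icc_eq_empty_of_lt hpq]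
  have hb : ∀ s ∈ Icc p q, |a s| ≤ max |a p| |a q| := fun s hs =>
    abs_le_max_abs_abs (h.monotoneOn (left_mem_Icc.2 hpq) hs hs.1)
      (h.monotoneOn hs (right_mem_Icc.2 hpq) hs.2)
  have hone : ∀ s ∈ Icc p q, ∀ t ∈ Icc p q, U s - U t ≤ max |a p| |a q| * |s - t| := by
    intro s hs t ht
    have h1 := h t ht s hs
    calc U s - U t ≤ a s * (s - t) := by linarith
      _ ≤ |a s * (s - t)| := le_abs_self _
      _ = |a s| * |s - t| := abs_mul _ _
      _ ≤ _ := by gcongr; exact hb s hs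
  have hL : LipschitzOnWith (max |a p| |a q|).toNNReal U (Icc p q) := by
    refine LipschitzOnWith.of_dist_le_mul fun s hs t ht => ?_
    rw [Real.coe_toNNReal _ (le_max_of_le_left (abs_nonneg _)), Real.dist_eq, Real.dist_eq,
      abs_sub_le_iff]
    exact ⟨hone s hs t ht, by rw [abs_sub_comm]; exact hone t ht s hs⟩
  exact hL.continuousOn

/-- The slope of `U` between `t` and `x` is squeezed between `a t` and `a x`. -/
theorem hasDerivAt (h : IsSubgradientOn S U a) {x : ℝ} (hS : S ∈ 𝓝 x) (ha : ContinuousAt a x) :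
    HasDerivAt U (a x) x := by
  rw [hasDerivAt_iff_tendsto_slope, tendsto_iff_norm_sub_tendsto_zero]
  have ha' : Tendsto (fun t => ‖a t - a x‖) (𝓝[≠] x) (𝓝 0) :=
    (tendsto_iff_norm_sub_tendsto_zero.1 ha.tendsto).mono_left nhdsWithin_le_nhds
  refine squeeze_zero' (Eventually.of_forall fun t => norm_nonneg _) ?_ ha'
  filter_upwards [mem_nhdsWithin_of_mem_nhds hS, self_mem_nhdsWithin] with t ht htx
  have hxS := mem_of_mem_nhds hS
  have h1 := h t ht x hxS
  have h2 := h x hxS t ht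
  have htx' : t ≠ x := htx
  rw [slope_def_field, Real.norm_eq_abs, Real.norm_eq_abs]
  rcases lt_or_gt_of_ne htx' with hlt | hlt
  · have e1 : a t ≤ (U t - U x) / (t - x) := by
      rw [le_div_iff_of_neg (by linarith)]; linarith
    have e2 : (U t - U x) / (t - x) ≤ a x := by
      rw [div_le_iff_of_neg (by linarith)]; linarith
    rw [abs_of_nonpos (by linarith), abs_of_nonpos (by linarith)]
    linarith
  · have e1 : a x ≤ (U t - U x) / (t - x) := by
      rw [le_div_iff₀ (by linarith)]; linarith
    have e2 : (U t - U x) / (t - x) ≤ a t := by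
      rw [div_le_iff₀ (by linarith)]; linarith
    rw [abs_of_nonneg (by linarith), abs_of_nonneg (by linarith)]
    linarith

theorem exists_countable_hasDerivAt (h : IsSubgradientOn (Icc p q) U a) :
    ∃ C : Set ℝ, C.Countable ∧ ∀ x ∈ Ioo p q \ C, HasDerivAt U (a x) x := by
  refine ⟨_, h.monotoneOn.countable_not_continuousWithinAt, fun x hx => ?_⟩
  have hn : Icc p q ∈ 𝓝 x := Icc_mem_nhds hx.1.1 hx.1.2
  refine h.hasDerivAt hn ?_
  by_contra hc
  exact hx.2 ⟨Ioo_subset_Icc_self hx.1, fun hc' => hc (hc'.continuousAt hn)⟩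

theorem intervalIntegrable (h : IsSubgradientOn (Icc p q) U a) (hpq : p ≤ q) :
    IntervalIntegrable a volume p q := by
  apply MonotoneOn.intervalIntegrable
  rw [uIcc_of_le hpq]
  exact h.monotoneOn

theorem intervalIntegrable_payoff (h : IsSubgradientOn (Icc p q) U a) (hpq : p ≤ q) {f : ℝ → ℝ}
    (hf : ContinuousOn f (Icc p q)) (β : ℝ) :
    IntervalIntegrable (fun s => (U s + β * a s) * f s) volume p q := by
  have hU : ContinuousOn U (uIcc p q) := by rw [uIcc_of_le hpq]; exact h.continuousOn
  have hf' : ContinuousOn f (uIcc p q) := by rwa [uIcc_of_le hpq]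
  exact (hU.intervalIntegrable.add ((h.intervalIntegrable hpq).const_mul β)).mul_continuousOn hf'

/-- Integration by parts for the difference of two convex functions against a density. -/
theorem integral_payoff_sub_eq {V v f : ℝ → ℝ} {β : ℝ} (hpq : p ≤ q)
    (hU : IsSubgradientOn (Icc p q) U a) (hV : IsSubgradientOn (Icc p q) V v)
    (hf : ContinuousOn f (Icc p q)) (hd : ∀ s ∈ Ioo p q, DifferentiableAt ℝ f s)
    (hi : IntervalIntegrable (fun s => f s - β * deriv f s) volume p q) :
    (∫ s in p..q, (U s + β * a s) * f s) - ∫ s in p..q, (V s + β * v s) * f s =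
      β * ((U q - V q) * f q - (U p - V p) * f p) +
        ∫ s in p..q, (U s - V s) * (f s - β * deriv f s) := by
  have hpay := (hU.intervalIntegrable_payoff hpq hf β).sub (hV.intervalIntegrable_payoff hpq hf β)
  have hcD : ContinuousOn (fun s => U s - V s) (Icc p q) := hU.continuousOn.sub hV.continuousOn
  have hwt : IntervalIntegrable (fun s => (U s - V s) * (f s - β * deriv f s)) volume p q :=
    hi.continuousOn_mul (by rwa [uIcc_of_le hpq])
  obtain ⟨C₁, hC₁, hU'⟩ := hU.exists_countable_hasDerivAt
  obtain ⟨C₂, hC₂, hV'⟩ := hV.exists_countable_hasDerivAt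
  have key := integral_eq_of_hasDerivAt_off_countable_of_le
    (fun s => β * ((U s - V s) * f s))
    (fun s => ((U s + β * a s) * f s - (V s + β * v s) * f s) -
      (U s - V s) * (f s - β * deriv f s)) hpq (hC₁.union hC₂)
    (continuousOn_const.mul (hcD.mul hf)) ?_ (hpay.sub hwt)
  · rw [intervalIntegral.integral_sub hpay hwt, intervalIntegral.integral_sub
      (hU.intervalIntegrable_payoff hpq hf β) (hV.intervalIntegrable_payoff hpq hf β)] at key
    linarith
  · intro x hx
    have h1 := hU' x ⟨hx.1, fun hc => hx.2 (Or.inl hc)⟩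
    have h2 := hV' x ⟨hx.1, fun hc => hx.2 (Or.inr hc)⟩
    refine (((h1.sub h2).mul (hd x hx.1).hasDerivAt).const_mul β).congr_deriv ?_
    simp only [Pi.sub_apply]
    ring

theorem integral_payoff_sub_le {V v f : ℝ → ℝ} {β : ℝ} (hpq : p ≤ q)
    (hU : IsSubgradientOn (Icc p q) U a) (hV : IsSubgradientOn (Icc p q) V v)
    (hf : ContinuousOn f (Icc p q)) (hd : ∀ s ∈ Ioo p q, DifferentiableAt ℝ f s)
    (hi : IntervalIntegrable (fun s => f s - β * deriv f s) volume p q)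
    (hsign : ∀ s ∈ Ioo p q, (U s - V s) * (f s - β * deriv f s) ≤ 0) :
    (∫ s in p..q, (U s + β * a s) * f s) - ∫ s in p..q, (V s + β * v s) * f s ≤
      β * ((U q - V q) * f q - (U p - V p) * f p) := by
  rw [integral_payoff_sub_eq hpq hU hV hf hd hi]
  have : ∫ s in p..q, (U s - V s) * (f s - β * deriv f s) ≤ ∫ s in p..q, (0 : ℝ) := by
    refine intervalIntegral.integral_mono_on_of_le_Ioo hpq
      (hi.continuousOn_mul ?_) intervalIntegrable_const hsign
    rw [uIcc_of_le hpq]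
    exact hU.continuousOn.sub hV.continuousOn
  simp only [intervalIntegral.integral_zero] at this
  linarith

end IsSubgradientOn

/-! ### Single-crossing weights and their cumulative integrals -/

/-- A continuous density `f` on `[lo, hi]` such that `f - β f'` changes sign at most once on the
interior, at `c`, from nonpositive to nonnegative. -/
structure SingleCrossing (f : ℝ → ℝ) (β lo c hi : ℝ) : Prop where
  mem : c ∈ Icc lo hi
  bias_nonneg : 0 ≤ β
  continuous : Continuous f
  nonneg : ∀ s ∈ Icc lo hi, 0 ≤ f s
  differentiable : ∀ s ∈ Ioo lo hi, DifferentiableAt ℝ f s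
  nonpos_left : ∀ s ∈ Ioo lo c, f s - β * deriv f s ≤ 0
  nonneg_right : ∀ s ∈ Ioo c hi, 0 ≤ f s - β * deriv f s

/-- The cumulative weight that the principal's objective puts on `[lo, x]`. -/
noncomputable def cumWeight (f : ℝ → ℝ) (β lo x : ℝ) : ℝ := (∫ s in lo..x, f s) - β * f x

/-- The principal's objective over `[lo, x]` evaluated at `s ↦ x - s`. -/
noncomputable def cumMoment (f : ℝ → ℝ) (β lo x : ℝ) : ℝ :=
  x * (∫ s in lo..x, f s) - (∫ s in lo..x, s * f s) - β * ∫ s in lo..x, f s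

section

variable {f : ℝ → ℝ} {β lo c hi x : ℝ}

theorem hasDerivAt_cumWeight (hf : Continuous f) (hd : DifferentiableAt ℝ f x) :
    HasDerivAt (cumWeight f β lo) (f x - β * deriv f x) x :=
  (hf.integral_hasStrictDerivAt lo x).hasDerivAt.sub (hd.hasDerivAt.const_mul β)

theorem continuous_cumWeight (hf : Continuous f) : Continuous (cumWeight f β lo) :=
  (intervalIntegral.continuous_primitive (fun a b => hf.intervalIntegrable a b) lo).sub
    (continuous_const.mul hf)

theorem hasDerivAt_cumMoment (hf : Continuous f) (x : ℝ) :
    HasDerivAt (cumMoment f β lo) (cumWeight f β lo x) x := by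
  have h1 := (hf.integral_hasStrictDerivAt lo x).hasDerivAt
  have h2 := ((continuous_id.mul hf).integral_hasStrictDerivAt lo x).hasDerivAt
  refine ((((hasDerivAt_id x).mul h1).sub h2).sub (h1.const_mul β)).congr_deriv ?_
  simp only [cumWeight, Pi.mul_apply, id]
  ring

theorem continuous_cumMoment (hf : Continuous f) : Continuous (cumMoment f β lo) :=
  continuous_iff_continuousAt.2 fun x => (hasDerivAt_cumMoment hf x).continuousAt

theorem cumWeight_self : cumWeight f β lo lo = -(β * f lo) := by simp [cumWeight]

theorem cumMoment_self : cumMoment f β lo lo = 0 := by simp [cumMoment]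

theorem integral_affine_payoff (hf : Continuous f) (u k x : ℝ) :
    ∫ s in lo..x, ((u + k * (s - x)) + β * k) * f s =
      u * (∫ s in lo..x, f s) - k * cumMoment f β lo x := by
  have h1 : ∀ s, ((u + k * (s - x)) + β * k) * f s =
      (u - k * x + β * k) * f s + k * (s * f s) := fun s => by ring
  simp only [h1]
  have i1 : IntervalIntegrable (fun s => (u - k * x + β * k) * f s) volume lo x :=
    (continuous_const.mul hf).intervalIntegrable _ _
  have i2 : IntervalIntegrable (fun s => k * (s * f s)) volume lo x :=
    (continuous_const.mul (continuous_id.mul hf)).intervalIntegrable _ _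
  rw [intervalIntegral.integral_add i1 i2, intervalIntegral.integral_const_mul,
    intervalIntegral.integral_const_mul, cumMoment]
  ring

theorem antitoneOn_cumMoment (hf : Continuous f) (h : ∀ t ∈ Icc lo x, cumWeight f β lo t ≤ 0) :
    AntitoneOn (cumMoment f β lo) (Icc lo x) := by
  refine antitoneOn_of_deriv_nonpos (convex_Icc _ _) (continuous_cumMoment hf).continuousOn
    (fun t _ => (hasDerivAt_cumMoment hf t).differentiableAt.differentiableWithinAt) fun t ht => ?_
  rw [interior_Icc] at ht
  rw [(hasDerivAt_cumMoment hf t).deriv]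
  exact h t (Ioo_subset_Icc_self ht)

namespace SingleCrossing

/-- `deriv f` need not be continuous. Integrability comes from the constant sign: the weight is the
derivative of the continuous `cumWeight`. -/
theorem intervalIntegrable_left (h : SingleCrossing f β lo c hi) :
    IntervalIntegrable (fun s => f s - β * deriv f s) volume lo c := by
  have hlc := h.mem.1
  have : IntervalIntegrable (fun s => -(f s - β * deriv f s)) volume lo c := by
    refine intervalIntegral.intervalIntegrable_deriv_of_nonneg
      (g := fun s => -cumWeight f β lo s) (continuous_cumWeight h.continuous).neg.continuousOn
      (fun s hs => ?_) (fun s hs => ?_)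
    all_goals rw [min_eq_left hlc, max_eq_right hlc] at hs
    · exact (hasDerivAt_cumWeight h.continuous
        (h.differentiable s ⟨hs.1, hs.2.trans_le h.mem.2⟩)).neg
    · exact neg_nonneg.2 (h.nonpos_left s hs)
  refine this.neg.congr fun s _ => ?_
  simp

theorem intervalIntegrable_right (h : SingleCrossing f β lo c hi) :
    IntervalIntegrable (fun s => f s - β * deriv f s) volume c hi := by
  have hch := h.mem.2
  refine intervalIntegral.intervalIntegrable_deriv_of_nonneg
    (g := cumWeight f β lo) (continuous_cumWeight h.continuous).continuousOn
    (fun s hs => ?_) (fun s hs => ?_)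
  all_goals rw [min_eq_left hch, max_eq_right hch] at hs
  · exact hasDerivAt_cumWeight h.continuous (h.differentiable s ⟨h.mem.1.trans_lt hs.1, hs.2⟩)
  · exact h.nonneg_right s hs

theorem intervalIntegrable (h : SingleCrossing f β lo c hi) :
    IntervalIntegrable (fun s => f s - β * deriv f s) volume lo hi :=
  h.intervalIntegrable_left.trans h.intervalIntegrable_right

theorem cumWeight_nonpos_left (h : SingleCrossing f β lo c hi) :
    ∀ t ∈ Icc lo c, cumWeight f β lo t ≤ 0 := by
  intro t ht
  have hanti : AntitoneOn (cumWeight f β lo) (Icc lo c) := by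
    have hda : ∀ s ∈ interior (Icc lo c),
        HasDerivAt (cumWeight f β lo) (f s - β * deriv f s) s := fun s hs => by
      rw [interior_Icc] at hs
      exact hasDerivAt_cumWeight h.continuous (h.differentiable s ⟨hs.1, hs.2.trans_le h.mem.2⟩)
    refine antitoneOn_of_deriv_nonpos (convex_Icc _ _)
      (continuous_cumWeight h.continuous).continuousOn
      (fun s hs => (hda s hs).differentiableAt.differentiableWithinAt) fun s hs => ?_
    rw [(hda s hs).deriv]
    rw [interior_Icc] at hs
    exact h.nonpos_left s hs
  refine (hanti (left_mem_Icc.2 h.mem.1) ht ht.1).trans ?_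
  rw [cumWeight_self]
  have := mul_nonneg h.bias_nonneg (h.nonneg lo (left_mem_Icc.2 (h.mem.1.trans h.mem.2)))
  linarith

theorem cumWeight_monotoneOn (h : SingleCrossing f β lo c hi) :
    MonotoneOn (cumWeight f β lo) (Icc c hi) := by
  have hda : ∀ s ∈ interior (Icc c hi),
      HasDerivAt (cumWeight f β lo) (f s - β * deriv f s) s := fun s hs => by
    rw [interior_Icc] at hs
    exact hasDerivAt_cumWeight h.continuous (h.differentiable s ⟨h.mem.1.trans_lt hs.1, hs.2⟩)
  refine monotoneOn_of_deriv_nonneg (convex_Icc _ _)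
    (continuous_cumWeight h.continuous).continuousOn
    (fun s hs => (hda s hs).differentiableAt.differentiableWithinAt) fun s hs => ?_
  rw [(hda s hs).deriv]
  rw [interior_Icc] at hs
  exact h.nonneg_right s hs

/-- Were `cumWeight` negative at `x`, it would be nonpositive on all of `[lo, x]`. Then `cumMoment`
would decrease from `0` to `0`, hence vanish identically, and its derivative at `x` would be zero.
-/
theorem cumWeight_nonneg_of_root (h : SingleCrossing f β lo c hi) (hx : x ∈ Icc c hi)
    (hlx : lo < x) (h0 : cumMoment f β lo x = 0) : 0 ≤ cumWeight f β lo x := by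
  by_contra! hneg
  have hle : ∀ t ∈ Icc lo x, cumWeight f β lo t ≤ 0 := by
    intro t ht
    rcases le_total t c with htc | htc
    · exact h.cumWeight_nonpos_left t ⟨ht.1, htc⟩
    · exact (h.cumWeight_monotoneOn ⟨htc, ht.2.trans hx.2⟩ hx ht.2).trans hneg.le
  have hanti := antitoneOn_cumMoment h.continuous hle
  have hzero : ∀ t ∈ Icc lo x, cumMoment f β lo t = 0 := fun t ht =>
    le_antisymm ((hanti (left_mem_Icc.2 hlx.le) ht ht.1).trans cumMoment_self.le)
      (h0.symm.le.trans (hanti ht (right_mem_Icc.2 hlx.le) ht.2))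
  have hxm : x ∈ Icc lo x := right_mem_Icc.2 hlx.le
  have hd0 : HasDerivWithinAt (cumMoment f β lo) 0 (Icc lo x) x :=
    (hasDerivWithinAt_const x (Icc lo x) (0 : ℝ)).congr hzero (hzero x hxm)
  exact hneg.ne ((uniqueDiffOn_Icc hlx x hxm).eq_deriv _
    (hasDerivAt_cumMoment h.continuous x).hasDerivWithinAt hd0)

theorem exists_cumMoment_eq_zero (h : SingleCrossing f β lo c hi) (hlh : lo < hi) (hβ : 0 < β)
    (hc : 0 < f c) (hhi : 0 ≤ cumMoment f β lo hi) :
    ∃ x ∈ Icc c hi, cumMoment f β lo x = 0 ∧ 0 ≤ cumWeight f β lo x := by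
  -- The point `lo` is always a root, but a useless one if `cumWeight` is negative there. Starting
  -- the intermediate value argument at some `y > lo` excludes it. When `c = lo`, such a `y` exists
  -- because `cumMoment` has slope `-β f lo < 0` at `lo`.
  obtain ⟨y, hy, hly, hy0⟩ : ∃ y ∈ Icc c hi, lo < y ∧ cumMoment f β lo y ≤ 0 := by
    rcases h.mem.1.eq_or_lt with rfl | hlc
    · have hneg : cumWeight f β lo lo < 0 := by
        rw [cumWeight_self]
        exact neg_neg_of_pos (mul_pos hβ hc)
      have hs := (hasDerivWithinAt_iff_tendsto_slope' self_notMem_Ioi).1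
        (hasDerivAt_cumMoment (β := β) (lo := lo) h.continuous lo).hasDerivWithinAt
      obtain ⟨y, hys, hy⟩ := ((hs.eventually_lt_const hneg).and (Ioc_mem_nhdsGT hlh)).exists
      refine ⟨y, ⟨hy.1.le, hy.2⟩, hy.1, ?_⟩
      rw [slope_def_field, cumMoment_self, div_lt_iff₀ (sub_pos.2 hy.1)] at hys
      linarith
    · refine ⟨c, left_mem_Icc.2 h.mem.2, hlc, ?_⟩
      exact (antitoneOn_cumMoment h.continuous h.cumWeight_nonpos_left (left_mem_Icc.2 hlc.le)
        (right_mem_Icc.2 hlc.le) hlc.le).trans cumMoment_self.le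
  obtain ⟨x, hx, hx0⟩ := intermediate_value_Icc hy.2
    (continuous_cumMoment (f := f) (β := β) (lo := lo) h.continuous).continuousOn ⟨hy0, hhi⟩
  have hxc : x ∈ Icc c hi := ⟨hy.1.trans hx.1, hx.2⟩
  exact ⟨x, hxc, hx0, h.cumWeight_nonneg_of_root hxc (hly.trans_le hx.1) hx0⟩

/-- On `[lo, x]` the objective is improved by replacing `U` with the chord through `c` and `x`. -/
theorem exists_affine_ge (h : SingleCrossing f β lo c hi) (hx : x ∈ Icc c hi) {U a : ℝ → ℝ}
    (hU : IsSubgradientOn (Icc lo hi) U a) :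
    ∃ k ≤ a x, ∫ s in lo..x, (U s + β * a s) * f s ≤
      U x * (∫ s in lo..x, f s) - k * cumMoment f β lo x := by
  have hlx : lo ≤ x := h.mem.1.trans hx.1
  have hxm : x ∈ Icc lo hi := ⟨hlx, hx.2⟩
  -- The sign of `U` minus the chord is opposite to that of the weight on both sides of `c`. If `x =
  -- c`, the tangent at `c` replaces the chord.
  obtain ⟨k, hk, hleft, hright⟩ : ∃ k ≤ a x, (∀ s ∈ Icc lo c, 0 ≤ U s - (U x + k * (s - x))) ∧
      ∀ s ∈ Icc c x, U s - (U x + k * (s - x)) ≤ 0 := by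
    rcases hx.1.eq_or_lt with rfl | hcx
    · refine ⟨a c, le_rfl, fun s hs => ?_, fun s hs => ?_⟩
      · have := hU s ⟨hs.1, hs.2.trans h.mem.2⟩ c h.mem
        linarith
      · obtain rfl : s = c := le_antisymm hs.2 hs.1
        simp
    · set k := (U x - U c) / (x - c) with hkdef
      have hkx : k * (x - c) = U x - U c := div_mul_cancel₀ _ (sub_pos.2 hcx).ne'
      refine ⟨k, ?_, fun s hs => ?_, fun s hs => ?_⟩
      · rw [hkdef, div_le_iff₀ (sub_pos.2 hcx)]
        have := hU c h.mem x hxm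
        linarith
      · have h1 := hU s ⟨hs.1, hs.2.trans h.mem.2⟩ c h.mem
        have h2 : a c ≤ k := by
          rw [hkdef, le_div_iff₀ (sub_pos.2 hcx)]
          have := hU x hxm c h.mem
          linarith
        nlinarith [mul_nonneg (sub_nonneg.2 h2) (sub_nonneg.2 hs.2)]
      · have hsm : s ∈ Icc lo hi := ⟨h.mem.1.trans hs.1, hs.2.trans hx.2⟩
        have h1 := mul_le_mul_of_nonneg_left (hU c h.mem s hsm) (sub_nonneg.2 hs.2)
        have h2 := mul_le_mul_of_nonneg_left (hU x hxm s hsm) (sub_nonneg.2 hs.1)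
        have h3 : U s * (x - c) ≤ (U x + k * (s - x)) * (x - c) := by
          have h4 : k * (s - x) * (x - c) = (U x - U c) * (s - x) := by
            rw [mul_right_comm, hkx]
          nlinarith
        have := le_of_mul_le_mul_right h3 (sub_pos.2 hcx)
        linarith
  refine ⟨k, hk, ?_⟩
  have hint : IntervalIntegrable (fun s => f s - β * deriv f s) volume lo x :=
    h.intervalIntegrable.mono_set (by
      rw [uIcc_of_le hlx, uIcc_of_le (hlx.trans hx.2)]; exact Icc_subset_Icc_right hx.2)
  have key := (hU.mono (Icc_subset_Icc_right hx.2)).integral_payoff_sub_le hlx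
    (IsSubgradientOn.affine _ (U x) k x) h.continuous.continuousOn
    (fun s hs => h.differentiable s ⟨hs.1, hs.2.trans_le hx.2⟩) hint ?_
  · rw [integral_affine_payoff h.continuous] at key
    -- The boundary term at `x` vanishes, as the chord meets `U` there; the one at `lo` has the
    -- right sign.
    have h1 := mul_nonneg h.bias_nonneg (mul_nonneg (hleft lo (left_mem_Icc.2 h.mem.1))
      (h.nonneg lo (left_mem_Icc.2 (hlx.trans hx.2))))
    simp only [sub_self, mul_zero, add_zero, zero_mul, zero_sub] at key
    linarith
  · intro s hs
    rcases lt_trichotomy s c with hsc | rfl | hsc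
    · exact mul_nonpos_of_nonneg_of_nonpos (hleft s ⟨hs.1.le, hsc.le⟩)
        (h.nonpos_left s ⟨hs.1, hsc⟩)
    · rw [le_antisymm (hright s ⟨le_rfl, hs.2.le⟩) (hleft s ⟨hs.1.le, le_rfl⟩), zero_mul]
    · exact mul_nonpos_of_nonpos_of_nonneg (hright s ⟨hsc.le, hs.2.le⟩)
        (h.nonneg_right s ⟨hsc, hs.2.trans_le hx.2⟩)

end SingleCrossing

end

/-! ### Log-concavity yields single crossing -/

/-- An exponential factor preserves log-concavity, and log-concave functions are quasi-concave.
Working with powers instead of logarithms allows zeros of `f`. -/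
theorem LogConcaveOn.min_exp_mul_le {S : Set ℝ} {f : ℝ → ℝ} (hf : LogConcaveOn S f)
    (h0 : ∀ s ∈ S, 0 ≤ f s) (r : ℝ) {x y z : ℝ} (hx : x ∈ S) (hz : z ∈ S) (hxy : x ≤ y)
    (hyz : y ≤ z) :
    min (Real.exp (r * x) * f x) (Real.exp (r * z) * f z) ≤ Real.exp (r * y) * f y := by
  rcases hxy.eq_or_lt with rfl | hxy'
  · exact min_le_left _ _
  have hxz : 0 < z - x := by linarith
  set t := (z - y) / (z - x) with ht
  have ht0 : 0 ≤ t := div_nonneg (sub_nonneg.2 hyz) hxz.le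
  have ht1 : t ≤ 1 := (div_le_one hxz).2 (by linarith)
  have hy : t * x + (1 - t) * z = y := by
    have : t * (z - x) = z - y := div_mul_cancel₀ _ hxz.ne'
    linarith
  have hlc := hf x hx z hz t ⟨ht0, ht1⟩
  rw [hy] at hlc
  set A := Real.exp (r * x) * f x with hA
  set B := Real.exp (r * z) * f z with hB
  have hA0 : 0 ≤ A := mul_nonneg (Real.exp_pos _).le (h0 x hx)
  have hB0 : 0 ≤ B := mul_nonneg (Real.exp_pos _).le (h0 z hz)
  have hm0 : 0 ≤ min A B := le_min hA0 hB0
  calc min A B = min A B ^ t * min A B ^ (1 - t) := by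
        rw [← Real.rpow_add_of_nonneg hm0 ht0 (by linarith)]
        simp
    _ ≤ A ^ t * B ^ (1 - t) := by
        gcongr
        · exact min_le_left _ _
        · exact min_le_right _ _
    _ = Real.exp (r * y) * (f x ^ t * f z ^ (1 - t)) := by
        rw [hA, hB, Real.mul_rpow (Real.exp_pos _).le (h0 x hx),
          Real.mul_rpow (Real.exp_pos _).le (h0 z hz), ← Real.exp_mul, ← Real.exp_mul, ← hy,
          show r * (t * x + (1 - t) * z) = r * x * t + r * z * (1 - t) by ring, Real.exp_add]
        ring
    _ ≤ _ := by gcongr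

theorem exists_singleCrossing {f : ℝ → ℝ} {β lo hi : ℝ} (hlh : lo ≤ hi) (hβ : 0 < β)
    (hf : Continuous f) (h0 : ∀ s ∈ Icc lo hi, 0 ≤ f s)
    (hd : ∀ s ∈ Ioo lo hi, DifferentiableAt ℝ f s) (hlog : LogConcaveOn (Icc lo hi) f)
    (hpos : ∃ s ∈ Icc lo hi, 0 < f s) :
    ∃ c, SingleCrossing f β lo c hi ∧ 0 < f c := by
  -- The derivative of `h` is a negative multiple of `f - β f'`, so the weight changes sign where
  -- the quasi-concave `h` peaks.
  set h : ℝ → ℝ := fun s => Real.exp (-β⁻¹ * s) * f s with hh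
  have hcont : Continuous h := by fun_prop
  obtain ⟨c, hc, hmax⟩ := isCompact_Icc.exists_isMaxOn (nonempty_Icc.2 hlh) hcont.continuousOn
  have hmax' : ∀ s ∈ Icc lo hi, h s ≤ h c := fun s hs => hmax hs
  have hder : ∀ s ∈ Ioo lo hi,
      HasDerivAt h (-(Real.exp (-β⁻¹ * s) * β⁻¹ * (f s - β * deriv f s))) s := by
    intro s hs
    refine ((((hasDerivAt_id s).const_mul (-β⁻¹)).exp).mul (hd s hs).hasDerivAt).congr_deriv ?_
    simp only [id]
    field_simp
    ring
  have hexp : ∀ s, 0 < Real.exp (-β⁻¹ * s) * β⁻¹ := fun s =>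
    mul_pos (Real.exp_pos _) (inv_pos.2 hβ)
  have hmono : MonotoneOn h (Icc lo c) := by
    intro s hs t ht hst
    have := hlog.min_exp_mul_le h0 (-β⁻¹) ⟨hs.1, hs.2.trans hc.2⟩ hc hst ht.2
    rwa [min_eq_left (hmax' s ⟨hs.1, hs.2.trans hc.2⟩)] at this
  have hanti : AntitoneOn h (Icc c hi) := by
    intro s hs t ht hst
    have := hlog.min_exp_mul_le h0 (-β⁻¹) hc ⟨hc.1.trans ht.1, ht.2⟩ hs.1 hst
    rwa [min_eq_right (hmax' t ⟨hc.1.trans ht.1, ht.2⟩)] at this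
  refine ⟨c, ⟨hc, hβ.le, hf, h0, hd, fun s hs => ?_, fun s hs => ?_⟩, ?_⟩
  · have h1 := hmono.derivWithin_nonneg (x := s)
    rw [derivWithin_of_mem_nhds (Icc_mem_nhds hs.1 hs.2),
      (hder s ⟨hs.1, hs.2.trans_le hc.2⟩).deriv] at h1
    by_contra! hcon
    linarith [mul_pos (hexp s) hcon]
  · have h1 := hanti.derivWithin_nonpos (x := s)
    rw [derivWithin_of_mem_nhds (Icc_mem_nhds hs.1 hs.2),
      (hder s ⟨hc.1.trans_lt hs.1, hs.2⟩).deriv] at h1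
    by_contra! hcon
    linarith [mul_neg_of_pos_of_neg (hexp s) hcon]
  · obtain ⟨s, hs, hs0⟩ := hpos
    have : 0 < h c := (mul_pos (Real.exp_pos _) hs0).trans_le (hmax' s hs)
    exact pos_of_mul_pos_right this (Real.exp_pos _).le

/-! ### Tangent continuation outside an interval -/

/-- The point of `[s₁, s₂]` closest to `s`, for `s₁ ≤ s₂`. -/
def clamp (s₁ s₂ s : ℝ) : ℝ := max s₁ (min s₂ s)

section clamp

variable {s₁ s₂ s : ℝ}

theorem clamp_mem (h : s₁ ≤ s₂) (s : ℝ) : clamp s₁ s₂ s ∈ Icc s₁ s₂ :=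
  ⟨le_max_left _ _, max_le h (min_le_left _ _)⟩

theorem clamp_of_le (h : s ≤ s₁) : clamp s₁ s₂ s = s₁ :=
  max_eq_left ((min_le_right _ _).trans h)

theorem clamp_of_mem (h : s ∈ Icc s₁ s₂) : clamp s₁ s₂ s = s := by
  rw [clamp, min_eq_right h.2, max_eq_right h.1]

theorem clamp_of_ge (h : s₁ ≤ s₂) (hs : s₂ ≤ s) : clamp s₁ s₂ s = s₂ := by
  rw [clamp, min_eq_left hs, max_eq_right h]

theorem clamp_neg (h : s₁ ≤ s₂) (s : ℝ) : clamp (-s₂) (-s₁) (-s) = -clamp s₁ s₂ s := by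
  rcases le_total s s₁ with hs | hs
  · rw [clamp_of_le hs, clamp_of_ge (neg_le_neg h) (neg_le_neg hs)]
  · rcases le_total s₂ s with hs' | hs'
    · rw [clamp_of_ge h hs', clamp_of_le (neg_le_neg hs')]
    · rw [clamp_of_mem ⟨hs, hs'⟩, clamp_of_mem ⟨neg_le_neg hs', neg_le_neg hs⟩]

end clamp

/-- Among the points of `[s₁, s₂]`, the tangent at the closest one is the highest at `s`. -/
theorem IsSubgradientOn.tangent_le_clamp {V v : ℝ → ℝ} (hV : IsSubgradientOn univ V v)
    {s₁ s₂ : ℝ} (h : s₁ ≤ s₂) (s : ℝ) {t : ℝ} (ht : t ∈ Icc s₁ s₂) :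
    V t + v t * (s - t) ≤
      V (clamp s₁ s₂ s) + v (clamp s₁ s₂ s) * (s - clamp s₁ s₂ s) := by
  have hmono := monotoneOn_univ.1 hV.monotoneOn
  rcases le_total s s₁ with hs | hs
  · rw [clamp_of_le hs]
    have h1 := hV s₁ trivial t trivial
    nlinarith [mul_nonneg (sub_nonneg.2 (hmono ht.1)) (sub_nonneg.2 hs)]
  · rcases le_total s₂ s with hs' | hs'
    · rw [clamp_of_ge h hs']
      have h1 := hV s₂ trivial t trivial
      nlinarith [mul_nonneg (sub_nonneg.2 (hmono ht.2)) (sub_nonneg.2 hs')]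
    · rw [clamp_of_mem ⟨hs, hs'⟩]
      have h1 := hV s trivial t trivial
      linarith

theorem IsSubgradientOn.clamp {V v : ℝ → ℝ} (hV : IsSubgradientOn univ V v) {s₁ s₂ : ℝ}
    (h : s₁ ≤ s₂) : IsSubgradientOn univ
      (fun s => V (clamp s₁ s₂ s) + v (clamp s₁ s₂ s) * (s - clamp s₁ s₂ s))
      (fun s => v (clamp s₁ s₂ s)) := by
  intro s _ s' _
  have := hV.tangent_le_clamp h s (clamp_mem h s')
  linarith

/-! ### Upper bounds on the principal's objective -/

/-- The principal's objective, at every convex function on `[lo, hi]` whose tangents lie below `V`,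
is at most its value at `V` continued from `[s₁, s₂]` along its tangents. -/
def DelegationBound (lo hi : ℝ) (f : ℝ → ℝ) (β : ℝ) (V v : ℝ → ℝ) (s₁ s₂ : ℝ) : Prop :=
  ∀ U a : ℝ → ℝ, IsSubgradientOn (Icc lo hi) U a →
    (∀ s ∈ Icc lo hi, ∀ x, U s + a s * (x - s) ≤ V x) →
    ∫ s in lo..hi, (U s + β * a s) * f s ≤
      ∫ s in lo..hi, ((V (clamp s₁ s₂ s) + v (clamp s₁ s₂ s) * (s - clamp s₁ s₂ s)) +
        β * v (clamp s₁ s₂ s)) * f s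

section

variable {f V v : ℝ → ℝ} {β lo c hi x : ℝ}

/-- At a root the part on `[lo, x]` is at most `U x` times the mass there. On `[x, hi]` the weight
is nonnegative and `U ≤ V`. Together with the boundary term at `x`, the loss is at least `V x - U x`
times `cumWeight`. -/
theorem SingleCrossing.delegationBound_of_root (h : SingleCrossing f β lo c hi)
    (hx : x ∈ Icc c hi) (h0 : cumMoment f β lo x = 0) (h1 : 0 ≤ cumWeight f β lo x)
    (hV : IsSubgradientOn univ V v) : DelegationBound lo hi f β V v x hi := by
  intro U a hU hUV
  have hlx : lo ≤ x := h.mem.1.trans hx.1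
  have hUx : U x ≤ V x := by simpa using hUV x ⟨hlx, hx.2⟩ x
  have hfc : ∀ S, ContinuousOn f S := fun S => h.continuous.continuousOn
  have hW := hV.clamp hx.2
  have hsplit : ∀ {Y y : ℝ → ℝ}, IsSubgradientOn (Icc lo hi) Y y →
      (∫ s in lo..x, (Y s + β * y s) * f s) + ∫ s in x..hi, (Y s + β * y s) * f s =
        ∫ s in lo..hi, (Y s + β * y s) * f s := fun hY =>
    intervalIntegral.integral_add_adjacent_intervals
      ((hY.mono (Icc_subset_Icc_right hx.2)).intervalIntegrable_payoff hlx (hfc _) β)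
      ((hY.mono (Icc_subset_Icc_left hlx)).intervalIntegrable_payoff hx.2 (hfc _) β)
  rw [← hsplit hU, ← hsplit (hW.mono (subset_univ _))]
  obtain ⟨k, -, hleft⟩ := h.exists_affine_ge hx hU
  rw [h0, mul_zero, sub_zero] at hleft
  have eleft : ∫ s in lo..x, ((V (Delegation.clamp x hi s) + v (Delegation.clamp x hi s) *
      (s - Delegation.clamp x hi s)) + β * v (Delegation.clamp x hi s)) * f s =
      V x * ∫ s in lo..x, f s := by
    rw [← sub_zero (V x * _), ← mul_zero (v x), ← h0, ← integral_affine_payoff h.continuous]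
    refine intervalIntegral.integral_congr fun s hs => ?_
    rw [uIcc_of_le hlx] at hs
    simp only [clamp_of_le hs.2]
  have eright : ∫ s in x..hi, ((V (Delegation.clamp x hi s) + v (Delegation.clamp x hi s) *
      (s - Delegation.clamp x hi s)) + β * v (Delegation.clamp x hi s)) * f s =
      ∫ s in x..hi, (V s + β * v s) * f s := by
    refine intervalIntegral.integral_congr fun s hs => ?_
    rw [uIcc_of_le hx.2] at hs
    simp only [clamp_of_mem hs, sub_self, mul_zero, add_zero]
  have hright := (hU.mono (Icc_subset_Icc_left hlx)).integral_payoff_sub_le hx.2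
    (hV.mono (subset_univ _)) (hfc _)
    (fun s hs => h.differentiable s ⟨hlx.trans_lt hs.1, hs.2⟩)
    (h.intervalIntegrable.mono_set (by
      rw [uIcc_of_le hx.2, uIcc_of_le (hlx.trans hx.2)]; exact Icc_subset_Icc_left hlx))
    (fun s hs => mul_nonpos_of_nonpos_of_nonneg
      (by simpa using hUV s ⟨hlx.trans hs.1.le, hs.2.le⟩ s)
      (h.nonneg_right s ⟨hx.1.trans_lt hs.1, hs.2⟩))
  have hhi : hi ∈ Icc lo hi := right_mem_Icc.2 (hlx.trans hx.2)
  have hUhi : U hi ≤ V hi := by simpa using hUV hi hhi hi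
  have e1 : β * ((U hi - V hi) * f hi) ≤ 0 := mul_nonpos_of_nonneg_of_nonpos h.bias_nonneg
    (mul_nonpos_of_nonpos_of_nonneg (sub_nonpos.2 hUhi) (h.nonneg hi hhi))
  have e2 := mul_nonneg (sub_nonneg.2 hUx) h1
  rw [cumWeight] at e2
  rw [eleft, eright]
  linarith

theorem SingleCrossing.delegationBound_of_neg (h : SingleCrossing f β lo c hi)
    (hone : ∫ s in lo..hi, f s = 1) (hneg : cumMoment f β lo hi ≤ 0) :
    DelegationBound lo hi f β V v (hi - cumMoment f β lo hi) (hi - cumMoment f β lo hi) := by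
  intro U a hU hUV
  -- This is the mean state plus `β`, where delegation to the single point `e` yields the principal
  -- exactly `V e`.
  set e := hi - cumMoment f β lo hi with he
  obtain ⟨k, hk, hle⟩ := h.exists_affine_ge ⟨h.mem.2, le_rfl⟩ hU
  have hclamp : ∀ s, Delegation.clamp e e s = e := fun s =>
    le_antisymm (clamp_mem le_rfl s).2 (clamp_mem le_rfl s).1
  simp only [hclamp]
  have hrw : ∫ s in lo..hi, ((V e + v e * (s - e)) + β * v e) * f s =
      ∫ s in lo..hi, (((V e + v e * (hi - e)) + v e * (s - hi)) + β * v e) * f s :=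
    intervalIntegral.integral_congr fun s _ => by ring
  rw [hrw, integral_affine_payoff h.continuous, hone]
  rw [hone] at hle
  -- The bound on `U` is the tangent at `hi` evaluated at `e`, which may lie outside `[lo, hi]`;
  -- hence tangents must be below `V` on all of `ℝ`.
  have := hUV hi (right_mem_Icc.2 (h.mem.1.trans h.mem.2)) e
  have hk' := mul_le_mul_of_nonneg_right hk (neg_nonneg.2 hneg)
  have e1 : e - hi = -cumMoment f β lo hi := by rw [he]; ring
  have e2 : hi - e = cumMoment f β lo hi := by rw [he]; ring
  rw [e1] at this
  rw [e2]
  linarith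

theorem exists_delegationBound_of_nonneg (hlh : lo < hi) (hβ : 0 ≤ β) (hf : Continuous f)
    (h0 : ∀ s ∈ Icc lo hi, 0 ≤ f s) (hd : ∀ s ∈ Ioo lo hi, DifferentiableAt ℝ f s)
    (hlog : LogConcaveOn (Icc lo hi) f) (hone : ∫ s in lo..hi, f s = 1)
    (hV : IsSubgradientOn univ V v) :
    ∃ s₁ s₂, s₁ ≤ s₂ ∧ DelegationBound lo hi f β V v s₁ s₂ ∧
      ((∫ s in lo..hi, s * f s) + β ∈ Icc lo hi → s₁ ∈ Icc lo hi ∧ s₂ ∈ Icc lo hi) := by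
  have hmom : cumMoment f β lo hi = hi - ((∫ s in lo..hi, s * f s) + β) := by
    rw [cumMoment, hone]
    ring
  rcases hβ.eq_or_lt with rfl | hβ
  -- Without bias the weight is `f ≥ 0`, so the crossing point and the root are both `lo`.
  · have hS : SingleCrossing f 0 lo lo hi :=
      ⟨left_mem_Icc.2 hlh.le, le_rfl, hf, h0, hd, by simp, fun s hs => by
        simpa using h0 s (Ioo_subset_Icc_self hs)⟩
    exact ⟨lo, hi, hlh.le, hS.delegationBound_of_root (left_mem_Icc.2 hlh.le) cumMoment_self
      (by simp [cumWeight_self]) hV,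
      fun _ => ⟨left_mem_Icc.2 hlh.le, right_mem_Icc.2 hlh.le⟩⟩
  have hpos : ∃ s ∈ Icc lo hi, 0 < f s := by
    by_contra! hcon
    have : ∫ s in lo..hi, f s = ∫ s in lo..hi, (0 : ℝ) := by
      refine intervalIntegral.integral_congr fun s hs => ?_
      rw [uIcc_of_le hlh.le] at hs
      exact le_antisymm (hcon s hs) (h0 s hs)
    simp [hone] at this
  obtain ⟨c, hS, hc⟩ := exists_singleCrossing hlh.le hβ hf h0 hd hlog hpos
  rcases le_total 0 (cumMoment f β lo hi) with hm | hm
  · obtain ⟨x, hx, hx0, hx1⟩ := hS.exists_cumMoment_eq_zero hlh hβ hc hm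
    exact ⟨x, hi, hx.2, hS.delegationBound_of_root hx hx0 hx1 hV,
      fun _ => ⟨⟨hS.mem.1.trans hx.1, hx.2⟩, right_mem_Icc.2 hlh.le⟩⟩
  · refine ⟨_, _, le_rfl, hS.delegationBound_of_neg hone hm, fun he => ?_⟩
    rw [hmom, sub_sub_cancel]
    exact ⟨he, he⟩

/-! ### Reflection for negative bias, and densities given only on the interval -/

theorem IsSubgradientOn.comp_neg {S : Set ℝ} {U a : ℝ → ℝ} (h : IsSubgradientOn S U a) :
    IsSubgradientOn (Neg.neg ⁻¹' S) (fun s => U (-s)) (fun s => -a (-s)) := by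
  intro s hs s' hs'
  have := h (-s) hs (-s') hs'
  linarith

theorem LogConcaveOn.comp_neg {S : Set ℝ} (h : LogConcaveOn S f) :
    LogConcaveOn (Neg.neg ⁻¹' S) (fun s => f (-s)) := by
  intro x hx y hy t ht
  have := h (-x) hx (-y) hy t ht
  rwa [show t * -x + (1 - t) * -y = -(t * x + (1 - t) * y) by ring] at this

theorem preimage_neg_Icc (p q : ℝ) : Neg.neg ⁻¹' Icc p q = Icc (-q) (-p) := by
  ext s
  exact ⟨fun h => ⟨by linarith [h.2], by linarith [h.1]⟩,
    fun h => ⟨by linarith [h.2], by linarith [h.1]⟩⟩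

theorem DelegationBound.of_comp_neg {s₁ s₂ : ℝ} (hs : s₁ ≤ s₂)
    (h : DelegationBound (-hi) (-lo) (fun s => f (-s)) (-β) (fun s => V (-s)) (fun s => -v (-s))
      s₁ s₂) : DelegationBound lo hi f β V v (-s₂) (-s₁) := by
  intro U a hU hUV
  have hU' := hU.comp_neg
  rw [preimage_neg_Icc] at hU'
  have key := h _ _ hU' fun s hs x => by
    have := hUV (-s) ⟨by linarith [hs.2], by linarith [hs.1]⟩ (-x)
    linarith
  have i1 := intervalIntegral.integral_comp_neg (a := -hi) (b := -lo)
    fun s => (U s + β * a s) * f s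
  have i2 := intervalIntegral.integral_comp_neg (a := -hi) (b := -lo)
    fun s => ((V (Delegation.clamp (-s₂) (-s₁) s) + v (Delegation.clamp (-s₂) (-s₁) s) *
      (s - Delegation.clamp (-s₂) (-s₁) s)) + β * v (Delegation.clamp (-s₂) (-s₁) s)) * f s
  rw [neg_neg, neg_neg] at i1 i2
  rw [← i1, ← i2]
  convert key using 4 with s s
  · ring
  · rw [clamp_neg hs]
    ring

theorem exists_delegationBound_of_continuous (hlh : lo < hi) (hf : Continuous f)
    (h0 : ∀ s ∈ Icc lo hi, 0 ≤ f s) (hd : ∀ s ∈ Ioo lo hi, DifferentiableAt ℝ f s)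
    (hlog : LogConcaveOn (Icc lo hi) f) (hone : ∫ s in lo..hi, f s = 1)
    (hV : IsSubgradientOn univ V v) :
    ∃ s₁ s₂, s₁ ≤ s₂ ∧ DelegationBound lo hi f β V v s₁ s₂ ∧
      ((∫ s in lo..hi, s * f s) + β ∈ Icc lo hi → s₁ ∈ Icc lo hi ∧ s₂ ∈ Icc lo hi) := by
  rcases le_total 0 β with hβ | hβ
  · exact exists_delegationBound_of_nonneg hlh hβ hf h0 hd hlog hone hV
  have hlog' := hlog.comp_neg
  have hV' := hV.comp_neg
  rw [preimage_neg_Icc] at hlog'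
  rw [preimage_univ] at hV'
  obtain ⟨s₁, s₂, hs, hB, hmem⟩ := exists_delegationBound_of_nonneg (neg_lt_neg hlh)
    (neg_nonneg.2 hβ) (hf.comp continuous_neg)
    (fun s hs => h0 (-s) ⟨by linarith [hs.2], by linarith [hs.1]⟩)
    (fun s hs => (hd (-s) ⟨by linarith [hs.2], by linarith [hs.1]⟩).comp s
      differentiable_neg.differentiableAt) hlog' (by
        simp [hone]) hV'
  refine ⟨-s₂, -s₁, neg_le_neg hs, hB.of_comp_neg hs, fun he => ?_⟩
  have hmean : ∫ s in -hi..-lo, s * (f ∘ fun s => -s) s = -∫ s in lo..hi, s * f s := by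
    have h1 := intervalIntegral.integral_comp_neg (a := -hi) (b := -lo) fun s => s * f s
    rw [neg_neg, neg_neg] at h1
    rw [← h1, ← intervalIntegral.integral_neg]
    exact intervalIntegral.integral_congr fun s _ => by simp
  rw [hmean] at hmem
  obtain ⟨m1, m2⟩ := hmem ⟨by linarith [he.2], by linarith [he.1]⟩
  exact ⟨⟨by linarith [m2.2], by linarith [m2.1]⟩, ⟨by linarith [m1.2], by linarith [m1.1]⟩⟩

theorem exists_delegationBound (hlh : lo < hi) (hf : DifferentiableOn ℝ f (Icc lo hi))
    (h0 : ∀ s ∈ Icc lo hi, 0 ≤ f s) (hlog : LogConcaveOn (Icc lo hi) f)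
    (hone : ∫ s in lo..hi, f s = 1) (hV : IsSubgradientOn univ V v) :
    ∃ s₁ s₂, s₁ ≤ s₂ ∧ DelegationBound lo hi f β V v s₁ s₂ ∧
      ((∫ s in lo..hi, s * f s) + β ∈ Icc lo hi → s₁ ∈ Icc lo hi ∧ s₂ ∈ Icc lo hi) := by
  -- The constant extension beyond the endpoints is continuous on `ℝ`, which makes its primitives
  -- differentiable everywhere.
  set F : ℝ → ℝ := IccExtend hlh.le ((Icc lo hi).domRestrict f) with hF
  have hFf : ∀ s ∈ Icc lo hi, F s = f s := fun s hs => by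
    rw [hF, IccExtend_of_mem _ _ hs, domRestrict_apply]
  have hint : ∀ g : ℝ → ℝ, ∫ s in lo..hi, g s * F s = ∫ s in lo..hi, g s * f s := fun g =>
    intervalIntegral.integral_congr fun s hs => by
      rw [uIcc_of_le hlh.le] at hs
      simp only [hFf s hs]
  have key := exists_delegationBound_of_continuous (f := F) (β := β) hlh
    hf.continuousOn.domRestrict.Icc_extend'
    (fun s hs => by rw [hFf s hs]; exact h0 s hs)
    (fun s hs => by
      have hn : Icc lo hi ∈ 𝓝 s := Icc_mem_nhds hs.1 hs.2
      refine (hf.differentiableAt hn).congr_of_eventuallyEq ?_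
      filter_upwards [hn] with t ht using hFf t ht)
    (fun x hx y hy t ht => by
      rw [hFf x hx, hFf y hy, hFf]
      · exact hlog x hx y hy t ht
      · exact convex_Icc lo hi hx hy ht.1 (sub_nonneg.2 ht.2) (by ring))
    (by rw [← hone]; simpa using hint 1) hV
  simpa only [DelegationBound, hint] using key

end

/-! ### First-best actions -/

theorem AdmissibleUtility.exists_isFirstBest {b : ℝ → ℝ} (hb : AdmissibleUtility b) (s : ℝ) :
    ∃ a, IsFirstBest b a s := by
  have hc : Continuous fun a => uA b a s :=
    (continuous_id.mul continuous_const).add hb.differentiable.continuous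
  refine hc.exists_forall_ge ?_
  have hlim : Tendsto (fun a : ℝ => -|a|) (cocompact ℝ) atBot :=
    tendsto_neg_atTop_atBot.comp tendsto_norm_cocompact_atTop
  refine tendsto_atBot_mono' _ ?_ hlim
  -- With this threshold the payoff is at most `-|a|`. It also rules out `a = 0`, where the quotient
  -- is `0` by convention.
  filter_upwards [hb.superlinear.eventually_le_atBot (-|s| - 1)] with a ha
  have ha0 : 0 < |a| := by
    rw [abs_pos]
    rintro rfl
    simp only [abs_zero, div_zero] at ha
    linarith [abs_nonneg s]
  rw [div_le_iff₀ ha0] at ha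
  have h1 : a * s ≤ |s| * |a| := by
    rw [mul_comm |s|, ← abs_mul]
    exact le_abs_self _
  simp only [uA]
  linarith

theorem AdmissibleUtility.isFirstBest_unique {b : ℝ → ℝ} (hb : AdmissibleUtility b) {a a' s : ℝ}
    (ha : IsFirstBest b a s) (ha' : IsFirstBest b a' s) : a = a' := by
  have hlin : ConcaveOn ℝ univ fun x : ℝ => x * s :=
    (LinearMap.mulRight ℝ s).concaveOn convex_univ
  exact (hlin.add_strictConcaveOn hb.strictConcave).eq_of_isMaxOn (fun x _ => ha x)
    (fun x _ => ha' x) trivial trivial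

/-! ### From lotteries and the state distribution to convex functions and interval integrals -/

section stateDist

variable {lo hi : ℝ} {f : ℝ → ℝ}

theorem aemeasurable_ofReal_density (hf : ContinuousOn f (Icc lo hi)) :
    AEMeasurable (fun s => ENNReal.ofReal (f s)) (volume.restrict (Icc lo hi)) :=
  (hf.aemeasurable measurableSet_Icc).ennreal_ofReal

theorem toReal_ofReal_smul_ae_eq (h0 : ∀ s ∈ Icc lo hi, 0 ≤ f s) (g : ℝ → ℝ) :
    (fun s => (ENNReal.ofReal (f s)).toReal • g s) =ᵐ[volume.restrict (Icc lo hi)]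
      fun s => g s * f s := by
  filter_upwards [ae_restrict_mem measurableSet_Icc] with s hs
  rw [ENNReal.toReal_ofReal (h0 s hs), smul_eq_mul, mul_comm]

theorem integral_stateDist (hlh : lo ≤ hi) (hf : ContinuousOn f (Icc lo hi))
    (h0 : ∀ s ∈ Icc lo hi, 0 ≤ f s) (g : ℝ → ℝ) :
    ∫ s, g s ∂(stateDist (Icc lo hi) f) = ∫ s in lo..hi, g s * f s := by
  rw [stateDist, integral_withDensity_eq_integral_toReal_smul₀ (aemeasurable_ofReal_density hf)
    (Eventually.of_forall fun _ => ENNReal.ofReal_lt_top),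
    integral_congr_ae (toReal_ofReal_smul_ae_eq h0 g), integral_Icc_eq_integral_Ioc,
    intervalIntegral.integral_of_le hlh]

theorem integrable_stateDist (hlh : lo ≤ hi) (hf : ContinuousOn f (Icc lo hi))
    (h0 : ∀ s ∈ Icc lo hi, 0 ≤ f s) {g : ℝ → ℝ}
    (hg : IntervalIntegrable (fun s => g s * f s) volume lo hi) :
    Integrable g (stateDist (Icc lo hi) f) := by
  rw [stateDist, integrable_withDensity_iff_integrable_smul₀' (aemeasurable_ofReal_density hf)
    (Eventually.of_forall fun _ => ENNReal.ofReal_lt_top),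
    integrable_congr (toReal_ofReal_smul_ae_eq h0 g)]
  exact (intervalIntegrable_iff_integrableOn_Icc_of_le hlh).1 hg

end stateDist

section mechanism

variable {b : ℝ → ℝ} {p : ProbabilityMeasure ℝ}

theorem expUA_eq (ha : Integrable (fun a : ℝ => a) (p : Measure ℝ))
    (hb : Integrable b (p : Measure ℝ)) (s : ℝ) :
    expUA b p s = (∫ a, a ∂(p : Measure ℝ)) * s + ∫ a, b a ∂(p : Measure ℝ) := by
  simp only [expUA, uA]
  rw [integral_add (ha.mul_const s) hb, integral_mul_const]

theorem expUP_eq (ha : Integrable (fun a : ℝ => a) (p : Measure ℝ))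
    (hb : Integrable b (p : Measure ℝ)) (β s : ℝ) :
    expUP b (fun s => s + β) 1 p s = expUA b p s + β * ∫ a, a ∂(p : Measure ℝ) := by
  rw [expUA_eq ha hb]
  simp only [expUP, uP, one_mul]
  rw [integral_add (ha.mul_const _) hb, integral_mul_const]
  ring

theorem expUA_le {a₀ s : ℝ} (h : IsFirstBest b a₀ s)
    (ha : Integrable (fun a : ℝ => a) (p : Measure ℝ)) (hb : Integrable b (p : Measure ℝ)) :
    expUA b p s ≤ uA b a₀ s := by
  calc expUA b p s ≤ ∫ _, uA b a₀ s ∂(p : Measure ℝ) :=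
        integral_mono ((ha.mul_const s).add hb) (integrable_const _) h
    _ = uA b a₀ s := by simp

end mechanism

/-- The lottery that yields `a` with certainty. -/
noncomputable def sureLottery (a : ℝ) : ProbabilityMeasure ℝ := ⟨Measure.dirac a, inferInstance⟩

theorem expUA_sureLottery (b : ℝ → ℝ) (a s : ℝ) : expUA b (sureLottery a) s = uA b a s :=
  integral_dirac _ _

theorem expUP_sureLottery (b : ℝ → ℝ) (β a s : ℝ) :
    expUP b (fun s => s + β) 1 (sureLottery a) s = uA b a s + β * a := by
  rw [expUP, sureLottery, ProbabilityMeasure.coe_mk, integral_dirac]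
  simp only [uP, uA]
  ring

/-- The payoff from a fixed report is affine in the true type, with the mean action as slope. -/
theorem IncentiveCompatible.isSubgradientOn {S : Set ℝ} {f b g : ℝ → ℝ} {κ : ℝ}
    {m : ℝ → ProbabilityMeasure ℝ} (hm : IsMechanism S f b g κ m)
    (hic : IncentiveCompatible S b m) :
    IsSubgradientOn S (fun s => expUA b (m s) s) (fun s => ∫ a, a ∂(m s : Measure ℝ)) := by
  intro s hs s' hs'
  have := hic s hs s' hs'
  rw [expUA_eq (hm.integrable_action s' hs') (hm.integrable_utility s' hs')] at this
  simp only
  rw [expUA_eq (hm.integrable_action s' hs') (hm.integrable_utility s' hs')]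
  linarith

theorem isSubgradientOn_firstBest {b v : ℝ → ℝ} (hv : ∀ s, IsFirstBest b (v s) s) :
    IsSubgradientOn univ (fun s => uA b (v s) s) v := by
  intro s _ s' _
  have := hv s (v s')
  simp only [uA] at this ⊢
  linarith

/-- Delegation to `[s₁, s₂]` when `v` selects first-best actions. -/
noncomputable def clampMechanism (v : ℝ → ℝ) (s₁ s₂ s : ℝ) : ProbabilityMeasure ℝ :=
  sureLottery (v (clamp s₁ s₂ s))

section clampMechanism

variable {lo hi s₁ s₂ β : ℝ} {f b v : ℝ → ℝ}

theorem uA_clamp (b v : ℝ → ℝ) (s₁ s₂ s t : ℝ) :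
    uA b (v (clamp s₁ s₂ t)) s = uA b (v (clamp s₁ s₂ t)) (clamp s₁ s₂ t) +
      v (clamp s₁ s₂ t) * (s - clamp s₁ s₂ t) := by
  simp only [uA]
  ring

theorem isSubgradientOn_clamp_firstBest (hv : ∀ s, IsFirstBest b (v s) s) (hs : s₁ ≤ s₂) :
    IsSubgradientOn univ (fun s => uA b (v (clamp s₁ s₂ s)) s) (fun s => v (clamp s₁ s₂ s)) := by
  have := (isSubgradientOn_firstBest hv).clamp hs
  simpa only [← uA_clamp] using this

theorem isMechanism_clampMechanism (hlh : lo ≤ hi) (hf : ContinuousOn f (Icc lo hi))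
    (h0 : ∀ s ∈ Icc lo hi, 0 ≤ f s) (hv : ∀ s, IsFirstBest b (v s) s) (hs : s₁ ≤ s₂) :
    IsMechanism (Icc lo hi) f b (fun s => s + β) 1 (clampMechanism v s₁ s₂) := by
  have hsub := (isSubgradientOn_clamp_firstBest hv hs).mono (subset_univ (Icc lo hi))
  refine ⟨fun s _ => integrable_dirac (by finiteness), fun s _ => integrable_dirac (by finiteness),
    ?_, ?_⟩
  · simp only [clampMechanism, expUA_sureLottery]
    refine integrable_stateDist hlh hf h0 ?_
    simpa using hsub.intervalIntegrable_payoff hlh hf 0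
  · simp only [clampMechanism, expUP_sureLottery]
    exact integrable_stateDist hlh hf h0 (hsub.intervalIntegrable_payoff hlh hf β)

theorem incentiveCompatible_clampMechanism (S : Set ℝ) (hv : ∀ s, IsFirstBest b (v s) s)
    (hs : s₁ ≤ s₂) : IncentiveCompatible S b (clampMechanism v s₁ s₂) := by
  intro s _ s' _
  have := isSubgradientOn_clamp_firstBest hv hs s trivial s' trivial
  simp only [clampMechanism, expUA_sureLottery, uA] at this ⊢
  linarith

theorem isDelegationTo_clampMechanism (S : Set ℝ) (hb : AdmissibleUtility b)
    (hv : ∀ s, IsFirstBest b (v s) s) (hs : s₁ ≤ s₂) :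
    IsDelegationTo S b (Icc s₁ s₂) (clampMechanism v s₁ s₂) := by
  intro s _
  refine ⟨v (clamp s₁ s₂ s), ⟨_, clamp_mem hs s, hv _⟩, ?_, rfl⟩
  rintro a ⟨t, ht, hat⟩
  obtain rfl := hb.isFirstBest_unique hat (hv t)
  have h1 := (isSubgradientOn_firstBest hv).tangent_le_clamp hs s ht
  simp only [uA] at h1 ⊢
  linarith

theorem isOptimal_clampMechanism (hlh : lo ≤ hi) (hf : ContinuousOn f (Icc lo hi))
    (h0 : ∀ s ∈ Icc lo hi, 0 ≤ f s) (hv : ∀ s, IsFirstBest b (v s) s) (hs : s₁ ≤ s₂)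
    (hB : DelegationBound lo hi f β (fun s => uA b (v s) s) v s₁ s₂) :
    IsOptimal (Icc lo hi) f b (fun s => s + β) 1 (clampMechanism v s₁ s₂) := by
  refine ⟨isMechanism_clampMechanism hlh hf h0 hv hs,
    incentiveCompatible_clampMechanism _ hv hs, fun m hm hic => ?_⟩
  -- The tangent at `s`, evaluated at `x`, is what type `x` would get from the lottery `m s`, hence
  -- at most its first-best payoff.
  have key := hB _ _ (hic.isSubgradientOn hm) fun s hs x => by
    have hle := expUA_le (hv x) (hm.integrable_action s hs) (hm.integrable_utility s hs)
    rw [expUA_eq (hm.integrable_action s hs) (hm.integrable_utility s hs)] at hle ⊢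
    linarith
  simp only [← uA_clamp] at key
  rw [principalValue, principalValue, integral_stateDist hlh hf h0, integral_stateDist hlh hf h0]
  simp only [clampMechanism, expUP_sureLottery]
  refine le_trans (le_of_eq ?_) key
  refine intervalIntegral.integral_congr fun s hs => ?_
  rw [uIcc_of_le hlh] at hs
  simp only [expUP_eq (hm.integrable_action s hs) (hm.integrable_utility s hs)]

end clampMechanism

end Delegation

theorem corollary3 (lo hi : ℝ) (hlohi : lo < hi) (f : ℝ → ℝ)
    (hf : Delegation.IsTypeDensity (Icc lo hi) f)
    (hlog : Delegation.LogConcaveOn (Icc lo hi) f)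
    (b : ℝ → ℝ) (hb : Delegation.AdmissibleUtility b) (β : ℝ) :
    ∃ s₁ s₂ : ℝ, s₁ ≤ s₂ ∧
      Delegation.DelegationOptimal (Icc lo hi) f b (fun s => s + β) 1 (Icc s₁ s₂) ∧
      ((∫ s, s ∂(Delegation.stateDist (Icc lo hi) f)) + β ∈ Icc lo hi →
        s₁ ∈ Icc lo hi ∧ s₂ ∈ Icc lo hi) := by
  choose v hv using hb.exists_isFirstBest
  have hfc := hf.differentiable.continuousOn
  have := hf.isProbability
  have hone : ∫ s in lo..hi, f s = 1 := by
    have h1 := Delegation.integral_stateDist hlohi.le hfc hf.nonneg 1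
    simpa using h1.symm
  obtain ⟨s₁, s₂, hs, hB, hmem⟩ := Delegation.exists_delegationBound (β := β) hlohi
    hf.differentiable hf.nonneg hlog hone (Delegation.isSubgradientOn_firstBest hv)
  refine ⟨s₁, s₂, hs, ⟨Delegation.clampMechanism v s₁ s₂,
    Delegation.isOptimal_clampMechanism hlohi.le hfc hf.nonneg hv hs hB,
    Delegation.isDelegationTo_clampMechanism _ hb hv hs⟩, ?_⟩
  rw [Delegation.integral_stateDist hlohi.le hfc hf.nonneg]
  exact hmem
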